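/- Let $G$ be a finitely generated virtually abelian group (equivalently, $G$ has a normal subgroup of finite index isomorphic to $\mathbb Z^k$ for some $k\ge 0$). Definitions. A subset $R$ of a monoid $M$ is *rational* if it is the image in $M$ of a regular language over a finite set of elements of $M$ (for $M=G$ one may take a finite generating set of $G$). An *EDT0L system* over a finite alphabet $\Sigma$ consists of a finite alphabet $C\supseteq\Sigma$, a start word $w_0\in C^*$, and a rational set $\mathcal R\subseteq\mathrm{End}(C^*)$; it accepts $\{\phi(w_0)\mid\phi\in\mathcal R\}$. A language over $\Sigma$ accepted by such a system is called *EDT0L*. For a group $H$, a finite-index normal subgroup of $H$ with a fixed identification with $\mathbb Z^k$, and a transversal $T$ of its cosets, let $a_i$ and $A_i$ be letters standing for the standard generator $e_i$ of $\mathbb Z^k$ and its inverse, ordered $a_1<A_1<a_2<A_2<\dots<a_k<A_k$, and let $$\mathrm{NF}(H)=\{\,v\,t \mid v\in\{a_1,A_1,\dots,a_k,A_k\}^* \text{ is the shortlex-least word representing its element of } \mathbb Z^k,\ t\in T\,\},$$ a language over the alphabet $\{a_1,A_1,\dots,a_k,A_k\}\sqcup T$. For $U\subseteq H$ let $\mathrm{NF}(U)$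 be the set of words in $\mathrm{NF}(H)$ that represent an element of $U$. Theorem. (1) For every choice of a finite-index normal subgroup of $G$ identified with some $\mathbb Z^k$, every transversal $T$ of it, and every rational subset $U\subseteq G$, the language $\mathrm{NF}(U)$ is EDT0L. (2) For every integer $n\ge 0$ and every subset $U\subseteq G^n$ definable by a first-order formula in the language of groups with parameters from $G$, the language $\mathrm{NF}(U)$ is EDT0L, for every choice of a finite-index normal subgroup of $G^n$ identified with some $\mathbb Z^m$ and every transversal of it (in particular for $\mathbb Z^{kn}\le G^n$ and $T^n$, with $\mathbb Z^k\le G$ and $T$ as in (1)). -/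

import Mathlib

universe u

/-! ### Rational subsets -/

/-- A subset `R` of a monoid `M` is rational if it is the image in `M` of a regular language over
some finite set `S` of elements of `M`, a word being sent to the product of its letters. When `M`
is finitely generated, `S` can always be enlarged to a finite (symmetric) generating set, so asking
in addition that `S` generates `M` gives the same notion. -/
def IsRationalSubset {M : Type*} [Monoid M] (R : Set M) : Prop :=
  ∃ (S : Finset M) (L : Language S), L.IsRegular ∧
    R = {m | ∃ w ∈ L, (w.map (fun s : S => (s : M))).prod = m}

/-! ### EDT0L languages -/

/-- An EDT0L system with terminal alphabet `α`: a finite extended alphabet `C` containing `α`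
(through the injection `incl`), a start word over `C`, and a rational control, that is, a rational
set of endomorphisms of the free monoid `C*`. -/
structure EDT0LSystem (α : Type u) where
  /-- the extended alphabet -/
  C : Type u
  finite_C : Finite C
  incl : α ↪ C
  start : FreeMonoid C
  control : Set (Monoid.End (FreeMonoid C))
  rational_control : IsRationalSubset control

/-- The set of words `φ(w)`, with `w` the start word and `φ` running through the control. -/
def EDT0LSystem.accepted {α : Type u} (H : EDT0LSystem α) : Set (FreeMonoid H.C) :=
  {v | ∃ φ ∈ H.control, φ H.start = v}

/-- A language over `α` is EDT0L if it is, as a set of words over the extended alphabet, the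
language accepted by an EDT0L system. (As `α` embeds in the finite type `C`, it is finite.) -/
def IsEDT0L {α : Type u} (L : Language α) : Prop :=
  ∃ H : EDT0LSystem α, H.accepted = {v | ∃ w ∈ L, FreeMonoid.ofList (w.map H.incl) = v}

/-! ### Virtually abelian groups and natural normal forms -/

/-- `G` has an abelian subgroup of finite index. -/
def IsVirtuallyAbelian (G : Type*) [Group G] : Prop :=
  ∃ A : Subgroup G, A.FiniteIndex ∧ ∀ x ∈ A, ∀ y ∈ A, x * y = y * x

/-- The letters `a₁ < A₁ < a₂ < A₂ < ⋯ < a_k < A_k`, in this order (lexicographic, `false < true`):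
`aᵢ` is `(i, false)` and `Aᵢ` is `(i, true)`. -/
abbrev ZLetter (k : ℕ) : Type := Fin k ×ₗ Bool

/-- The element of `ℤ^k` represented by a letter: `aᵢ ↦ eᵢ` and `Aᵢ ↦ -eᵢ`. -/
def ZLetter.toVec {k : ℕ} (x : ZLetter k) : Fin k → ℤ :=
  Pi.single (ofLex x).1 (if (ofLex x).2 then -1 else 1)

/-- The element of `ℤ^k` represented by a word. -/
def wordVec {k : ℕ} (w : List (ZLetter k)) : Fin k → ℤ :=
  (w.map ZLetter.toVec).sum

/-- `w` is the shortlex representative of the element of `ℤ^k` that it represents. -/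
def IsShortlexRep {k : ℕ} (w : List (ZLetter k)) : Prop :=
  ∀ v : List (ZLetter k), wordVec v = wordVec w → ¬ List.Shortlex (· < ·) v w

/-- The choices on which natural normal forms in `G` depend: a finite index normal subgroup of `G`
identified with `ℤ^k` through an injective homomorphism `emb`, and a transversal `T` of its
cosets (every element of `G` is `z * t` for a unique `z` in the subgroup and a unique `t ∈ T`). -/
structure NFData (G : Type u) [Group G] where
  k : ℕ
  emb : Multiplicative (Fin k → ℤ) →* G
  emb_injective : Function.Injective emb
  normal : emb.range.Normal
  finiteIndex : emb.range.FiniteIndex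
  /-- the transversal -/
  T : Set G
  isComplement : Subgroup.IsComplement (emb.range : Set G) T

/-- The alphabet `{a₁, A₁, …, a_k, A_k} ⊔ T`. -/
abbrev NFData.Letter {G : Type u} [Group G] (D : NFData G) : Type u := ZLetter D.k ⊕ D.T

/-- The element of `G` represented by a letter. -/
def NFData.letterVal {G : Type u} [Group G] (D : NFData G) : D.Letter → G
  | Sum.inl x => D.emb (Multiplicative.ofAdd x.toVec)
  | Sum.inr t => t

/-- The element of `G` represented by a word. -/
def NFData.val {G : Type u} [Group G] (D : NFData G) (w : List D.Letter) : G :=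
  (w.map D.letterVal).prod

/-- The language `NF(G)` of natural normal forms: a shortlex representative of an element of `ℤ^k`
followed by a single letter from the transversal. -/
def NFData.all {G : Type u} [Group G] (D : NFData G) : Language D.Letter :=
  {w | ∃ (v : List (ZLetter D.k)) (t : D.T), IsShortlexRep v ∧ w = v.map Sum.inl ++ [Sum.inr t]}

/-- `NF(U)`: the words in `NF(G)` that represent an element of `U`. -/
def NFData.NF {G : Type u} [Group G] (D : NFData G) (U : Set G) : Language D.Letter :=
  {w | w ∈ D.all ∧ D.val w ∈ U}

/-! ### Definable sets -/

/-- Function symbols of the first-order language of groups. -/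
inductive GroupFunc : ℕ → Type
  | one : GroupFunc 0
  | inv : GroupFunc 1
  | mul : GroupFunc 2

/-- The first-order language of groups. -/
def groupLanguage : FirstOrder.Language where
  Functions := GroupFunc
  Relations := fun _ => Empty

/-- A group as a structure for the language of groups. -/
instance groupStructure (G : Type*) [Group G] : groupLanguage.Structure G where
  funMap
    | GroupFunc.one, _ => 1
    | GroupFunc.inv, x => (x 0)⁻¹
    | GroupFunc.mul, x => x 0 * x 1
  RelMap := fun r _ => r.elim

/-- A subset of `G^n` is definable if it is the set of tuples satisfying a first-order formula in
the language of groups with parameters from `G`. -/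
def IsDefinableSubset {G : Type*} [Group G] {n : ℕ} (U : Set (Fin n → G)) : Prop :=
  (Set.univ : Set G).Definable groupLanguage U

/-! Both parts reduce to semilinearity of the traces `{z | emb z * t ∈ U}` in `ℤ^k`, one for each of
the finitely many `t` in the transversal.

Semilinear traces suffice (`NFData.isEDT0L_NF`). Shortlex words are the words `x₁^{m₁} ⋯ x_k^{m_k}`
with `xᵢ ∈ {aᵢ, Aᵢ}` (`isShortlexRep_iff`), so after fixing signs and `t` the exponents run through
finitely many linear sets `c + ⟨P⟩` in `ℕ^k`. An EDT0L system produces these from one marker per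
exponent: each period is an endomorphism pumping all markers at once, and a closing one inserts `c`
and `t` (`isEDT0L_powerWords`).

Rational `U`: pair the automaton's state with the current coset. Reading a letter adds a vector of
`ℤ^k`, so the trace is a set of path weights in a finite graph, and eliminating vertices as in
Kleene's theorem builds it from finite sets by unions, sums and generated submonoids
(`WalkWeight.isSemilinearSet`).

Definable `U`: along `z ↦ φ z * h` each term is, on cosets of some `N ℤ^ι`, a translate of a
homomorphism into an abelian normal subgroup, so equations have semilinear solution sets.
Connectives use closure under complement; `G` is a finite union of translates of an image of `ℤ^k`,
so quantifiers become finite unions of projections (`IsQuasiAffine.isSemilinearSet_realize`). -/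

/-! ### Shortlex representatives in `ℤ^k` -/

/-- The word `x₁^{m₁} ⋯ x_k^{m_k}`, where `xᵢ` is `Aᵢ` if `s i` holds and `aᵢ` otherwise. -/
def signWord {k : ℕ} (s : Fin k → Bool) (m : Fin k → ℕ) : List (ZLetter k) :=
  (List.finRange k).flatMap fun i => List.replicate (m i) (toLex (i, s i))

/-- The element of `ℤ^k` with absolute values `m` and signs `s`, as a homomorphism in `m`. -/
def signVec {k : ℕ} (s : Fin k → Bool) : (Fin k → ℕ) →+ (Fin k → ℤ) where
  toFun m i := if s i then -(m i : ℤ) else m i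
  map_zero' := by ext i; simp
  map_add' a b := by
    ext i
    by_cases h : s i = true <;> simp [h]
    ring

lemma wordVec_apply {k : ℕ} (w : List (ZLetter k)) (i : Fin k) :
    wordVec w i = (w.count (toLex (i, false)) : ℤ) - w.count (toLex (i, true)) := by
  induction w with
  | nil => simp [wordVec]
  | cons x w ih =>
    obtain ⟨⟨j, b⟩, rfl⟩ := toLex.surjective x
    have h : wordVec (toLex (j, b) :: w) i = Pi.single (M := fun _ => ℤ) j (if b then -1 else 1) i
        + wordVec w i := by
      simp only [wordVec, List.map_cons, List.sum_cons, Pi.add_apply]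
      rfl
    rw [h, ih, List.count_cons, List.count_cons, Pi.single_apply]
    have e : ∀ c : Bool, ((toLex (j, b) : ZLetter k) == toLex (i, c)) = decide (j = i ∧ b = c) := by
      intro c
      rw [Bool.eq_iff_iff]
      simp
    rw [e, e]
    by_cases hij : i = j
    · subst hij
      cases b <;> simp <;> ring
    · have hji : ¬ j = i := fun h => hij h.symm
      simp [hij, hji]

lemma count_signWord {k : ℕ} (s : Fin k → Bool) (m : Fin k → ℕ) (i : Fin k) (b : Bool) :
    (signWord s m).count (toLex (i, b)) = if b = s i then m i else 0 := by
  have e : ∀ j, List.count (toLex (i, b)) (List.replicate (m j) (toLex (j, s j)))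
      = if j = i then (if b = s i then m i else 0) else 0 := by
    intro j
    rw [List.count_replicate]
    by_cases hj : j = i
    · subst hj
      by_cases hb : b = s j
      · simp [hb]
      · have : ¬ s j = b := fun h => hb h.symm
        simp [hb, this]
    · simp [hj]
  rw [signWord, List.count_flatMap]
  have : (List.count (toLex (i, b)) ∘ fun i => List.replicate (m i) (toLex (i, s i)))
      = fun j => if j = i then (if b = s i then m i else 0) else 0 := funext e
  rw [this, ← List.sum_toFinset _ (List.nodup_finRange k)]
  simp

lemma wordVec_signWord {k : ℕ} (s : Fin k → Bool) (m : Fin k → ℕ) :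
    wordVec (signWord s m) = signVec s m := by
  ext i
  rw [wordVec_apply, count_signWord, count_signWord]
  simp only [signVec, AddMonoidHom.coe_mk, ZeroHom.coe_mk]
  cases s i <;> simp

lemma pairwise_signWord {k : ℕ} (s : Fin k → Bool) (m : Fin k → ℕ) :
    (signWord s m).Pairwise (· ≤ ·) := by
  rw [signWord, List.pairwise_flatMap]
  refine ⟨fun i _ => List.pairwise_replicate_of_refl, ?_⟩
  refine (List.pairwise_lt_finRange k).imp ?_
  intro a b hab x hx y hy
  rw [List.eq_of_mem_replicate hx, List.eq_of_mem_replicate hy]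
  exact (Prod.Lex.toLex_lt_toLex.2 (Or.inl hab)).le

/-- The head of a sorted list is at most every entry of a rearrangement, so the first place of
disagreement favours the sorted list. -/
lemma List.Perm.eq_or_lex_of_pairwise_le {α : Type*} [LinearOrder α] {l l' : List α}
    (h : l.Perm l') (hl : l.Pairwise (· ≤ ·)) : l' = l ∨ List.Lex (· < ·) l l' := by
  induction l generalizing l' with
  | nil => exact Or.inl (List.nil_perm.1 h)
  | cons a l ih =>
    cases l' with
    | nil => exact absurd h.length_eq (by simp)
    | cons b l' =>
      have hab : a ≤ b := by
        rcases List.mem_cons.1 (h.mem_iff.2 List.mem_cons_self) with rfl | hb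
        · exact le_rfl
        · exact (List.pairwise_cons.1 hl).1 b hb
      rcases hab.eq_or_lt with rfl | hlt
      · rcases ih ((List.perm_cons a).1 h) (List.pairwise_cons.1 hl).2 with rfl | h'
        · exact Or.inl rfl
        · exact Or.inr (List.Lex.cons h')
      · exact Or.inr (List.Lex.rel hlt)

/-- The vector fixes the difference of the numbers of `aᵢ` and `Aᵢ`, so any word for it contains at
least the letters of `signWord s m`. It is longer, or a rearrangement of this sorted word. -/
lemma eq_or_shortlex_signWord {k : ℕ} (s : Fin k → Bool) (m : Fin k → ℕ) (v : List (ZLetter k))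
    (hv : wordVec v = wordVec (signWord s m)) :
    v = signWord s m ∨ List.Shortlex (· < ·) (signWord s m) v := by
  have hsub : (signWord s m).Subperm v := by
    rw [← Multiset.coe_le, Multiset.le_iff_count]
    intro x
    obtain ⟨⟨i, b⟩, rfl⟩ := toLex.surjective x
    have h := congrFun hv i
    rw [wordVec_apply, wordVec_signWord] at h
    simp only [signVec, AddMonoidHom.coe_mk, ZeroHom.coe_mk] at h
    rw [Multiset.coe_count, Multiset.coe_count]
    suffices hle : (signWord s m).count (toLex (i, b)) ≤ v.count (toLex (i, b)) by
      convert hle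
    rw [count_signWord]
    split_ifs with hb
    · subst hb
      revert h
      cases s i <;> simp <;> omega
    · exact Nat.zero_le _
  rcases hsub.length_le.eq_or_lt with hlen | hlen
  · rcases (hsub.perm_of_length_le hlen.ge).eq_or_lex_of_pairwise_le (pairwise_signWord s m)
      with h | h
    · exact Or.inl h
    · exact Or.inr (List.Shortlex.of_lex hlen h)
  · exact Or.inr (List.Shortlex.of_length_lt hlen)

/-- The shortlex representatives are the words `x₁^{m₁} ⋯ x_k^{m_k}` with `xᵢ ∈ {aᵢ, Aᵢ}`. -/
theorem isShortlexRep_iff {k : ℕ} (w : List (ZLetter k)) :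
    IsShortlexRep w ↔ ∃ s m, w = signWord s m := by
  constructor
  · intro hw
    have hvec : wordVec w = wordVec (signWord (fun i => decide (wordVec w i < 0))
        fun i => (wordVec w i).natAbs) := by
      rw [wordVec_signWord]
      ext i
      simp only [signVec, AddMonoidHom.coe_mk, ZeroHom.coe_mk, decide_eq_true_eq]
      split_ifs <;> omega
    rcases eq_or_shortlex_signWord _ _ w hvec with h | h
    · exact ⟨_, _, h⟩
    · exact absurd h (hw _ hvec.symm)
  · rintro ⟨s, m, rfl⟩ v hv hlt
    rcases eq_or_shortlex_signWord s m v hv with rfl | h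
    · exact asymm hlt hlt
    · exact asymm hlt h

/-! ### Semilinear families of words are EDT0L -/

lemma Language.isRegular_cons_of_forall_mem {α : Type*} (a : α) (Q : Set α) :
    Language.IsRegular ({w | ∃ l : List α, w = a :: l ∧ ∀ y ∈ l, y ∈ Q} : Language α) := by
  classical
  -- `none`: nothing read yet; `some b`: whether the word read so far conforms.
  let M : DFA α (Option Bool) :=
    { step := fun q x => match q with
        | none => some (decide (x = a))
        | some b => some (b && decide (x ∈ Q))
      start := none
      accept := {some true} }
  have hev : ∀ (l : List α) (b : Bool),
      M.evalFrom (some b) l = some (b && decide (∀ y ∈ l, y ∈ Q)) := by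
    intro l
    induction l with
    | nil => intro b; simp
    | cons y l ih =>
      intro b
      change M.evalFrom (some (b && decide (y ∈ Q))) l = _
      rw [ih]
      cases b <;> simp
  refine ⟨_, inferInstance, M, ?_⟩
  ext w
  rw [DFA.mem_accepts]
  cases w with
  | nil =>
    constructor
    · intro h
      cases h
    · rintro ⟨l, h, _⟩
      cases h
  | cons y l =>
    change M.evalFrom (some (decide (y = a))) l ∈ ({some true} : Set _) ↔ _
    rw [hev]
    constructor
    · intro h
      have h' := (Bool.and_eq_true _ _).mp (Option.some.inj h)
      have h1 := of_decide_eq_true h'.1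
      exact ⟨l, by rw [h1], of_decide_eq_true h'.2⟩
    · rintro ⟨l', h, hl⟩
      obtain ⟨rfl, rfl⟩ := List.cons.inj h
      simpa using hl

lemma Language.IsRegular.iUnion {α J : Type*} [Finite J] (L : J → Language α)
    (h : ∀ j, (L j).IsRegular) : Language.IsRegular ({w | ∃ j, w ∈ L j} : Language α) := by
  classical
  have := Fintype.ofFinite J
  have key : ∀ s : Finset J, Language.IsRegular ({w | ∃ j ∈ s, w ∈ L j} : Language α) := by
    intro s
    induction s using Finset.induction_on with
    | empty =>
      refine ⟨Unit, inferInstance, ⟨fun _ _ => (), (), ∅⟩, ?_⟩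
      ext w
      rw [DFA.mem_accepts]
      constructor
      · intro h
        exact h.elim
      · rintro ⟨j, hj, _⟩
        simp at hj
    | insert j s _ ih =>
      refine (congrArg Language.IsRegular ?_).mpr ((h j).add ih)
      ext w
      refine Iff.trans ?_ (Language.mem_add _ _ _).symm
      constructor
      · rintro ⟨i, hi, hw⟩
        rcases Finset.mem_insert.1 hi with rfl | hi
        · exact Or.inl hw
        · exact Or.inr ⟨i, hi, hw⟩
      · rintro (hw | ⟨i, hi, hw⟩)
        · exact ⟨j, Finset.mem_insert_self _ _, hw⟩
        · exact ⟨i, Finset.mem_insert_of_mem hi, hw⟩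
  refine (congrArg Language.IsRegular ?_).mpr (key Finset.univ)
  ext w
  constructor
  · rintro ⟨j, hj⟩
    exact ⟨j, Finset.mem_univ _, hj⟩
  · rintro ⟨j, _, hj⟩
    exact ⟨j, hj⟩

/-- The shape of the EDT0L controls below. Products of endomorphisms act from the right, so the
factor `f j` on the left is applied last. -/
lemma isRationalSubset_mul_list_prod {M ι J : Type*} [Monoid M] [Finite J] (f : J → M)
    (e : J → ι → M) (P : J → Finset ι) :
    IsRationalSubset {m : M | ∃ (j : J) (l : List ι), (∀ y ∈ l, y ∈ P j) ∧
      m = f j * (l.map (e j)).prod} := by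
  classical
  have := Fintype.ofFinite J
  let S : Finset M := Finset.univ.image f ∪ Finset.univ.biUnion fun j => (P j).image (e j)
  have hf : ∀ j, f j ∈ S := fun j =>
    Finset.mem_union_left _ (Finset.mem_image_of_mem _ (Finset.mem_univ _))
  have he : ∀ j, ∀ y ∈ P j, e j y ∈ S := fun j y hy => Finset.mem_union_right _
    (Finset.mem_biUnion.2 ⟨j, Finset.mem_univ _, Finset.mem_image_of_mem _ hy⟩)
  refine ⟨S, _, Language.IsRegular.iUnion _ fun j : J =>
    Language.isRegular_cons_of_forall_mem (⟨f j, hf j⟩ : S) {x | ∃ y ∈ P j, (x : M) = e j y}, ?_⟩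
  ext m
  constructor
  · rintro ⟨j, l, hl, rfl⟩
    refine ⟨⟨f j, hf j⟩ :: l.attach.map fun y : {y // y ∈ l} => ⟨e j y, he j y (hl y y.2)⟩,
      ⟨j, _, rfl, ?_⟩, ?_⟩
    · intro x hx
      obtain ⟨y, _, rfl⟩ := List.mem_map.1 hx
      exact ⟨y, hl y y.2, rfl⟩
    · rw [List.map_cons, List.prod_cons, List.map_map]
      congr 2
      conv_rhs => rw [← List.attach_map_subtype_val l, List.map_map]
      rfl
  · rintro ⟨w, ⟨j, l, rfl, hl⟩, rfl⟩
    refine ⟨j, ?_⟩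
    suffices h : ∃ l' : List ι, (∀ y ∈ l', y ∈ P j) ∧
        (l.map (fun s : S => (s : M))) = l'.map (e j) by
      obtain ⟨l', hl', h⟩ := h
      exact ⟨l', hl', by rw [List.map_cons, List.prod_cons, h]⟩
    induction l with
    | nil => exact ⟨[], by simp, rfl⟩
    | cons x l ih =>
      obtain ⟨l', hl', h⟩ := ih fun y hy => hl y (List.mem_cons_of_mem _ hy)
      obtain ⟨y, hy, hxy⟩ := hl x List.mem_cons_self
      refine ⟨y :: l', ?_, by rw [List.map_cons, List.map_cons, h, hxy]⟩
      intro z hz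
      rcases List.mem_cons.1 hz with rfl | hz
      · exact hy
      · exact hl' z hz

section PowerWords

variable {α : Type u} {k : ℕ}

/-- The alphabet `α` with a marker for each exponent and an end marker. -/
abbrev MarkedLetter (α : Type u) (k : ℕ) : Type u := α ⊕ ULift.{u} (Option (Fin k))

/-- The endomorphism sending the `i`-th marker `#ᵢ` to `(x i)^{m i} #ᵢ`. -/
def pumpEnd (x : Fin k → α) (m : Fin k → ℕ) : Monoid.End (FreeMonoid (MarkedLetter α k)) :=
  FreeMonoid.lift fun
    | Sum.inl a => FreeMonoid.of (Sum.inl a)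
    | Sum.inr ⟨some i⟩ =>
      FreeMonoid.of (Sum.inl (x i)) ^ m i * FreeMonoid.of (Sum.inr ⟨some i⟩)
    | Sum.inr ⟨none⟩ => FreeMonoid.of (Sum.inr ⟨none⟩)

/-- The endomorphism sending the `i`-th marker to `(x i)^{c i}` and the end marker to `t`. -/
def closeEnd (x : Fin k → α) (t : α) (c : Fin k → ℕ) :
    Monoid.End (FreeMonoid (MarkedLetter α k)) :=
  FreeMonoid.lift fun
    | Sum.inl a => FreeMonoid.of (Sum.inl a)
    | Sum.inr ⟨some i⟩ => FreeMonoid.of (Sum.inl (x i)) ^ c i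
    | Sum.inr ⟨none⟩ => FreeMonoid.of (Sum.inl t)

section apply

variable (x : Fin k → α) (t a : α) (m : Fin k → ℕ) (i : Fin k)

@[simp] lemma pumpEnd_letter :
    pumpEnd x m (FreeMonoid.of (Sum.inl a)) = FreeMonoid.of (Sum.inl a) :=
  FreeMonoid.lift_eval_of _ _

@[simp] lemma pumpEnd_marker : pumpEnd x m (FreeMonoid.of (Sum.inr ⟨some i⟩)) =
    FreeMonoid.of (Sum.inl (x i)) ^ m i * FreeMonoid.of (Sum.inr ⟨some i⟩) :=
  FreeMonoid.lift_eval_of _ _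

@[simp] lemma pumpEnd_endMarker :
    pumpEnd x m (FreeMonoid.of (Sum.inr ⟨none⟩)) = FreeMonoid.of (Sum.inr ⟨none⟩) :=
  FreeMonoid.lift_eval_of _ _

@[simp] lemma closeEnd_letter :
    closeEnd x t m (FreeMonoid.of (Sum.inl a)) = FreeMonoid.of (Sum.inl a) :=
  FreeMonoid.lift_eval_of _ _

@[simp] lemma closeEnd_marker : closeEnd x t m (FreeMonoid.of (Sum.inr ⟨some i⟩)) =
    FreeMonoid.of (Sum.inl (x i)) ^ m i :=
  FreeMonoid.lift_eval_of _ _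

@[simp] lemma closeEnd_endMarker :
    closeEnd x t m (FreeMonoid.of (Sum.inr ⟨none⟩)) = FreeMonoid.of (Sum.inl t) :=
  FreeMonoid.lift_eval_of _ _

end apply

/-- Endomorphisms of a free monoid agreeing on the letters are equal. -/
lemma FreeMonoid.end_ext {β : Type*} {f g : Monoid.End (FreeMonoid β)}
    (h : ∀ y, f (FreeMonoid.of y) = g (FreeMonoid.of y)) : f = g :=
  FreeMonoid.hom_eq h

lemma pumpEnd_zero (x : Fin k → α) : pumpEnd x 0 = 1 := by
  refine FreeMonoid.end_ext fun y => ?_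
  change _ = FreeMonoid.of y
  rcases y with a | ⟨_ | i⟩ <;> simp

/-- Pumping fixes the letters already written and keeps the marker, so exponents just accumulate. -/
lemma pumpEnd_add (x : Fin k → α) (m n : Fin k → ℕ) :
    pumpEnd x (m + n) = pumpEnd x m * pumpEnd x n := by
  refine FreeMonoid.end_ext fun y => ?_
  change _ = pumpEnd x m (pumpEnd x n (FreeMonoid.of y))
  rcases y with a | ⟨_ | i⟩
  · simp
  · simp
  · simp only [pumpEnd_marker, map_mul, map_pow, pumpEnd_letter, Pi.add_apply]
    rw [← mul_assoc, ← pow_add, add_comm]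

lemma closeEnd_mul_pumpEnd (x : Fin k → α) (t : α) (c m : Fin k → ℕ) :
    closeEnd x t c * pumpEnd x m = closeEnd x t (c + m) := by
  refine FreeMonoid.end_ext fun y => ?_
  change closeEnd x t c (pumpEnd x m (FreeMonoid.of y)) = _
  rcases y with a | ⟨_ | i⟩
  · simp
  · simp
  · simp only [pumpEnd_marker, closeEnd_marker, map_mul, map_pow, closeEnd_letter, Pi.add_apply]
    rw [← pow_add, add_comm]

lemma pumpEnd_list_sum (x : Fin k → α) (l : List (Fin k → ℕ)) :
    (l.map (pumpEnd x)).prod = pumpEnd x l.sum := by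
  induction l with
  | nil => simp [pumpEnd_zero]
  | cons m l ih => rw [List.map_cons, List.prod_cons, ih, List.sum_cons, pumpEnd_add]

lemma closeEnd_start (x : Fin k → α) (t : α) (c : Fin k → ℕ) :
    closeEnd x t c (FreeMonoid.ofList
      ((List.finRange k).map (fun i => Sum.inr ⟨some i⟩) ++ [Sum.inr ⟨none⟩])) =
    FreeMonoid.ofList (((List.finRange k).flatMap (fun i => List.replicate (c i) (x i)) ++ [t]).map
      Sum.inl) := by
  have hpow : ∀ (y : MarkedLetter α k) (n : ℕ),
      FreeMonoid.of y ^ n = FreeMonoid.ofList (List.replicate n y) := by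
    intro y n
    induction n with
    | zero => rfl
    | succ n ih => rw [pow_succ', ih]; rfl
  have hlist : ∀ l : List (Fin k), closeEnd x t c (FreeMonoid.ofList
      (l.map (fun i => Sum.inr ⟨some i⟩))) =
      FreeMonoid.ofList ((l.flatMap (fun i => List.replicate (c i) (x i))).map Sum.inl) := by
    intro l
    induction l with
    | nil => simp
    | cons i l ih =>
      rw [List.map_cons, FreeMonoid.ofList_cons, map_mul, ih, List.flatMap_cons, List.map_append,
        FreeMonoid.ofList_append, List.map_replicate, ← hpow, closeEnd_marker]
  rw [FreeMonoid.ofList_append, map_mul, hlist, List.map_append, FreeMonoid.ofList_append]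
  simp

/-- A finite union of sets of words `x₁^{m₁} ⋯ x_k^{m_k} t`, with `m` running through a linear
subset of `ℕ^k`, is EDT0L. -/
theorem isEDT0L_powerWords [Finite α] {J : Type*} [Finite J] (x : J → Fin k → α) (t : J → α)
    (c : J → Fin k → ℕ) (P : J → Finset (Fin k → ℕ)) :
    IsEDT0L ({w | ∃ j, ∃ m ∈ AddSubmonoid.closure (P j : Set (Fin k → ℕ)),
      w = (List.finRange k).flatMap (fun i => List.replicate ((c j + m) i) (x j i)) ++ [t j]} :
      Language α) := by
  refine ⟨⟨MarkedLetter α k, inferInstance, ⟨Sum.inl, Sum.inl_injective⟩, FreeMonoid.ofList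
    ((List.finRange k).map (fun i => Sum.inr ⟨some i⟩) ++ [Sum.inr ⟨none⟩]), _,
    isRationalSubset_mul_list_prod (fun j => closeEnd (x j) (t j) (c j))
      (fun j => pumpEnd (x j)) P⟩, ?_⟩
  ext v
  constructor
  · rintro ⟨_, ⟨j, l, hl, rfl⟩, rfl⟩
    refine ⟨_, ⟨j, l.sum, AddSubmonoid.list_sum_mem _ fun y hy =>
      AddSubmonoid.subset_closure (hl y hy), rfl⟩, ?_⟩
    rw [pumpEnd_list_sum, closeEnd_mul_pumpEnd, closeEnd_start]
    rfl
  · rintro ⟨_, ⟨j, m, hm, rfl⟩, rfl⟩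
    obtain ⟨l, hl, rfl⟩ := AddSubmonoid.exists_list_of_mem_closure hm
    refine ⟨_, ⟨j, l, hl, rfl⟩, ?_⟩
    rw [pumpEnd_list_sum, closeEnd_mul_pumpEnd, closeEnd_start]
    rfl

end PowerWords

/-! ### From semilinear traces to EDT0L normal forms -/

namespace NFData

variable {G : Type u} [Group G] (D : NFData G)

lemma finite_T : Finite D.T := by
  have := D.finiteIndex
  exact (D.isComplement.finite_right_iff).2 inferInstance

lemma val_map_inl (w : List (ZLetter D.k)) :
    D.val (w.map Sum.inl) = D.emb (Multiplicative.ofAdd (wordVec w)) := by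
  induction w with
  | nil => simp [NFData.val, wordVec]
  | cons x w ih =>
    have h : wordVec (x :: w) = x.toVec + wordVec w := by simp [wordVec]
    rw [h, ofAdd_add, map_mul, ← ih]
    rfl

lemma mem_NF_iff (U : Set G) (w : List D.Letter) :
    w ∈ D.NF U ↔ ∃ (s : Fin D.k → Bool) (t : D.T) (m : Fin D.k → ℕ),
      D.emb (Multiplicative.ofAdd (signVec s m)) * t ∈ U ∧
      w = (signWord s m).map Sum.inl ++ [Sum.inr t] := by
  have hval : ∀ s m (t : D.T), D.val ((signWord s m).map Sum.inl ++ [Sum.inr t]) =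
      D.emb (Multiplicative.ofAdd (signVec s m)) * t := by
    intro s m t
    rw [← wordVec_signWord, ← val_map_inl]
    simp [NFData.val, NFData.letterVal]
  constructor
  · rintro ⟨⟨v, t, hv, rfl⟩, hU⟩
    obtain ⟨s, m, rfl⟩ := (isShortlexRep_iff v).1 hv
    exact ⟨s, t, m, hval s m t ▸ hU, rfl⟩
  · rintro ⟨s, t, m, hU, rfl⟩
    exact ⟨⟨_, t, (isShortlexRep_iff _).2 ⟨s, m, rfl⟩, rfl⟩, show D.val _ ∈ U from
      (hval s m t).symm ▸ hU⟩

/-- If the trace of `U` on each coset of `ℤ^k` is semilinear, then `NF(U)` is EDT0L. -/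
theorem isEDT0L_NF (U : Set G)
    (hU : ∀ t : D.T, IsSemilinearSet
      {z : Fin D.k → ℤ | D.emb (Multiplicative.ofAdd z) * t ∈ U}) :
    IsEDT0L (D.NF U) := by
  have := D.finite_T
  -- Sign patterns overlap where an exponent is zero; this is harmless, as only a union is needed.
  have hX : ∀ p : (Fin D.k → Bool) × D.T, IsSemilinearSet {m : Fin D.k → ℕ |
      D.emb (Multiplicative.ofAdd (signVec p.1 m)) * p.2 ∈ U} :=
    fun p => (hU p.2).preimage (signVec p.1)
  simp only [isSemilinearSet_iff, isLinearSet_iff] at hX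
  choose S hS hSU using hX
  choose c P hcP using hS
  let J : Type _ := Σ p : (Fin D.k → Bool) × D.T, S p
  have hLetter : Finite D.Letter := inferInstanceAs (Finite ((Fin D.k × Bool) ⊕ D.T))
  refine (congrArg IsEDT0L ?_).mpr (isEDT0L_powerWords (J := J)
    (fun j i => (Sum.inl (toLex (i, j.1.1 i)) : D.Letter))
    (fun j => Sum.inr j.1.2) (fun j => c j.1 j.2 j.2.2) (fun j => P j.1 j.2 j.2.2))
  have hword : ∀ (s : Fin D.k → Bool) (m : Fin D.k → ℕ),
      (List.finRange D.k).flatMap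
        (fun i => List.replicate (m i) (Sum.inl (toLex (i, s i)) : D.Letter)) =
      (signWord s m).map Sum.inl := by
    intro s m
    simp [signWord, List.map_flatMap]
  ext w
  rw [mem_NF_iff]
  constructor
  · rintro ⟨s, t, m, hm, rfl⟩
    have hm' : m ∈ ⋃₀ (S (s, t) : Set (Set (Fin D.k → ℕ))) := by
      rw [← hSU (s, t)]
      exact hm
    obtain ⟨X, hX, hmX⟩ := hm'
    rw [hcP (s, t) X hX] at hmX
    obtain ⟨y, hy, rfl⟩ := hmX
    exact ⟨⟨(s, t), X, hX⟩, y, hy, by rw [hword]; rfl⟩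
  · rintro ⟨⟨⟨s, t⟩, X, hX⟩, y, hy, rfl⟩
    refine ⟨s, t, c (s, t) X hX + y, ?_, by rw [hword]⟩
    have hm' : c (s, t) X hX + y ∈ {m : Fin D.k → ℕ |
        D.emb (Multiplicative.ofAdd (signVec s m)) * t ∈ U} := by
      rw [hSU (s, t)]
      refine ⟨X, hX, ?_⟩
      exact (hcP (s, t) X hX).symm.subset ⟨y, hy, rfl⟩
    exact hm'

end NFData

/-! ### Path weights in finite graphs, and rational subsets -/

/-- `WalkWeight E S p q m`: there is a nonempty walk from `p` to `q` of total weight `m`, with edges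
in `E` and all its intermediate vertices in `S`. -/
inductive WalkWeight {σ M : Type*} [AddCommMonoid M] (E : σ → σ → M → Prop) (S : Set σ) :
    σ → σ → M → Prop
  | single {p q : σ} {m : M} : E p q m → WalkWeight E S p q m
  | cons {p r q : σ} {m n : M} : E p r m → r ∈ S → WalkWeight E S r q n →
      WalkWeight E S p q (m + n)

namespace WalkWeight

variable {σ M : Type*} [AddCommMonoid M] {E : σ → σ → M → Prop} {S S' : Set σ}

lemma mono (h : S ⊆ S') {p q : σ} {m : M} (hm : WalkWeight E S p q m) : WalkWeight E S' p q m := by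
  induction hm with
  | single he => exact single he
  | cons he hr _ ih => exact cons he (h hr) ih

lemma trans {p r q : σ} {m n : M} (hm : WalkWeight E S p r m) (hr : r ∈ S)
    (hn : WalkWeight E S r q n) : WalkWeight E S p q (m + n) := by
  induction hm with
  | single he => exact cons he hr hn
  | cons he hs _ ih =>
    rw [add_assoc]
    exact cons he hs (ih hr hn)

lemma closure_add {r q : σ} {m n : M} (hr : r ∈ S)
    (hm : m ∈ AddSubmonoid.closure {a | WalkWeight E S r r a}) (hn : WalkWeight E S r q n) :
    WalkWeight E S r q (m + n) := by
  induction hm using AddSubmonoid.closure_induction generalizing n with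
  | mem a ha => exact trans ha hr hn
  | zero => rwa [zero_add]
  | add a b _ _ iha ihb =>
    rw [add_assoc]
    exact iha (ihb hn)

open scoped Pointwise in
-- Cut a walk at its intermediate visits to `r`: a piece from `p` to `r`, loops at `r`, and a piece
-- from `r` to `q`, all avoiding `r` inside unless `r ∈ S` already. By commutativity the loop
-- weights contribute a generated submonoid.
lemma setOf_insert (r p q : σ) :
    {m | WalkWeight E (insert r S) p q m} = {m | WalkWeight E S p q m} ∪
      ({m | WalkWeight E S p r m} +
        (AddSubmonoid.closure {m | WalkWeight E S r r m} : Set M) +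
        {m | WalkWeight E S r q m}) := by
  have hS : S ⊆ insert r S := Set.subset_insert r S
  have hr : r ∈ insert r S := Set.mem_insert r S
  ext m
  constructor
  · intro hm
    change WalkWeight E (insert r S) p q m at hm
    induction hm with
    | single he => exact Or.inl (single he)
    | cons he hs _ ih =>
      rcases hs with rfl | hs
      · rcases ih with h | ⟨_, ⟨a, ha, c, hc, rfl⟩, b, hb, rfl⟩
        · exact Or.inr ⟨_, ⟨_, single he, 0, zero_mem _, rfl⟩, _, h, by simp⟩
        · exact Or.inr ⟨_, ⟨_, single he, a + c,
            add_mem (AddSubmonoid.subset_closure ha) hc, rfl⟩, b, hb, by simp only [add_assoc]⟩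
      · rcases ih with h | ⟨_, ⟨a, ha, c, hc, rfl⟩, b, hb, rfl⟩
        · exact Or.inl (cons he hs h)
        · exact Or.inr ⟨_, ⟨_, cons he hs ha, c, hc, rfl⟩, b, hb, by simp only [add_assoc]⟩
  · rintro (h | ⟨_, ⟨a, ha, c, hc, rfl⟩, b, hb, rfl⟩)
    · exact mono hS h
    · change WalkWeight E (insert r S) p q (a + c + b)
      rw [add_assoc]
      refine trans (mono hS ha) hr (closure_add hr ?_ (mono hS hb))
      exact AddSubmonoid.closure_mono (fun _ h => mono hS h) hc

theorem isSemilinearSet [Finite σ] (hE : ∀ p q, IsSemilinearSet {m | E p q m}) (p q : σ) :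
    IsSemilinearSet {m | WalkWeight E Set.univ p q m} := by
  classical
  have := Fintype.ofFinite σ
  have key : ∀ (S : Finset σ) (p q : σ), IsSemilinearSet {m | WalkWeight E (S : Set σ) p q m} := by
    intro S
    induction S using Finset.induction_on with
    | empty =>
      intro p q
      convert! hE p q using 2
      ext m
      constructor
      · intro h
        cases h with
        | single he => exact he
        | cons _ hs _ => simp at hs
      · exact single
    | insert r S _ ih =>
      intro p q
      rw [Finset.coe_insert, setOf_insert]
      exact (ih p q).union (((ih p r).add (ih r r).closure).add (ih r q))
  simpa using key Finset.univ p q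

end WalkWeight

/-! ### Rational subsets have semilinear traces -/

namespace NFData

variable {G : Type u} [Group G] (D : NFData G)

lemma exists_eq_emb_mul (g : G) : ∃ (z : Fin D.k → ℤ) (t : D.T),
    g = D.emb (Multiplicative.ofAdd z) * t := by
  obtain ⟨⟨⟨_, z, rfl⟩, t⟩, h⟩ := D.isComplement.2 g
  exact ⟨z, t, h.symm⟩

/-- If `U` is rational, then its trace on each coset of `ℤ^k` is semilinear. -/
theorem isSemilinearSet_of_isRationalSubset {U : Set G} (hU : IsRationalSubset U) (t : D.T) :
    IsSemilinearSet {z : Fin D.k → ℤ | D.emb (Multiplicative.ofAdd z) * t ∈ U} := by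
  obtain ⟨S, _, ⟨σ, _, A, rfl⟩, rfl⟩ := hU
  have := D.finite_T
  -- The `ℤ^k`-part produced by each letter is moved to the left, where these parts add up along a
  -- run.
  let E : σ × D.T → σ × D.T → (Fin D.k → ℤ) → Prop := fun p q z =>
    ∃ s : S, A.step p.1 s = q.1 ∧ (p.2 : G) * s = D.emb (Multiplicative.ofAdd z) * q.2
  have hE : ∀ p q, IsSemilinearSet {z | E p q z} := by
    intro p q
    have : {z | E p q z} = ⋃ s : S, {z | A.step p.1 s = q.1 ∧
        (p.2 : G) * s = D.emb (Multiplicative.ofAdd z) * q.2} := by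
      ext z
      simp [E]
    rw [this]
    refine IsSemilinearSet.iUnion fun s => IsSemilinearSet.of_finite (Set.Subsingleton.finite ?_)
    rintro z ⟨_, hz⟩ z' ⟨_, hz'⟩
    exact D.emb_injective (mul_right_cancel (hz.symm.trans hz'))
  have hwalk : ∀ p q z, WalkWeight E Set.univ p q z → ∃ w : List S, A.evalFrom p.1 w = q.1 ∧
      (p.2 : G) * (w.map (fun s : S => (s : G))).prod = D.emb (Multiplicative.ofAdd z) * q.2 := by
    intro p q z h
    induction h with
    | single he =>
      obtain ⟨s, hs, hz⟩ := he
      exact ⟨[s], by simpa using hs, by simpa using hz⟩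
    | cons he _ _ ih =>
      obtain ⟨s, hs, hz⟩ := he
      obtain ⟨w, hw, hz'⟩ := ih
      refine ⟨s :: w, by rw [DFA.evalFrom_cons, hs, hw], ?_⟩
      rw [List.map_cons, List.prod_cons, ← mul_assoc, hz, mul_assoc, hz', ofAdd_add, map_mul,
        mul_assoc]
  have hword : ∀ (w : List S) (p q : σ × D.T) (z : Fin D.k → ℤ), A.evalFrom p.1 w = q.1 →
      (p.2 : G) * (w.map (fun s : S => (s : G))).prod = D.emb (Multiplicative.ofAdd z) * q.2 →
      -- The empty word is separate because `WalkWeight` only sees nonempty walks.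
      (p = q ∧ z = 0) ∨ WalkWeight E Set.univ p q z := by
    intro w
    induction w with
    | nil =>
      intro p q z h1 h2
      left
      rw [List.map_nil, List.prod_nil, mul_one] at h2
      have h3 := @D.isComplement.1 (⟨D.emb 1, ⟨1, rfl⟩⟩, p.2)
        (⟨D.emb (Multiplicative.ofAdd z), ⟨_, rfl⟩⟩, q.2) (by simpa using h2)
      obtain ⟨h4, h5⟩ := Prod.mk_inj.1 h3
      exact ⟨Prod.ext h1 h5, (D.emb_injective (Subtype.ext_iff.1 h4)).symm⟩
    | cons s w ih =>
      intro p q z h1 h2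
      right
      obtain ⟨z₁, t₁, h3⟩ := D.exists_eq_emb_mul (p.2 * s)
      have he : E p (A.step p.1 s, t₁) z₁ := ⟨s, rfl, h3⟩
      have hz : z = z₁ + (-z₁ + z) := by abel
      rcases ih (A.step p.1 s, t₁) q (-z₁ + z) h1 (by
        rw [List.map_cons, List.prod_cons, ← mul_assoc, h3, mul_assoc] at h2
        rw [ofAdd_add, ofAdd_neg, map_mul, map_inv, mul_assoc, ← h2, inv_mul_cancel_left])
        with ⟨h4, h5⟩ | h4
      · rw [hz, h5, add_zero, ← h4]
        exact .single he
      · rw [hz]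
        exact .cons he (Set.mem_univ _) h4
  -- The transversal need not contain `1`: runs start at the representative `t₀` of its coset, and
  -- the weights are finally shifted by `z₀`.
  obtain ⟨z₀, t₀, h₀⟩ := D.exists_eq_emb_mul 1
  have hfin : IsSemilinearSet (⋃ q : {q : σ // q ∈ A.accept},
      ({z : Fin D.k → ℤ | (A.start, t₀) = (q.1, t) ∧ z = 0} ∪
        {z | WalkWeight E Set.univ (A.start, t₀) (q.1, t) z})) := by
    refine IsSemilinearSet.iUnion fun q => IsSemilinearSet.union ?_
      (WalkWeight.isSemilinearSet hE _ _)
    exact IsSemilinearSet.of_finite ((Set.finite_singleton 0).subset fun z hz => hz.2)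
  convert! hfin.vadd z₀ using 1
  ext z
  constructor
  · rintro ⟨w, hw, hz⟩
    refine ⟨-z₀ + z, Set.mem_iUnion.2 ⟨⟨A.eval w, hw⟩, ?_⟩, by simp⟩
    refine hword w (A.start, t₀) (A.eval w, t) (-z₀ + z) rfl ?_
    have ht₀ : (t₀ : G) = (D.emb (Multiplicative.ofAdd z₀))⁻¹ :=
      (inv_eq_of_mul_eq_one_right h₀.symm).symm
    rw [hz, ofAdd_add, ofAdd_neg, map_mul, map_inv, mul_assoc, ht₀]
  · rintro ⟨y, hy, rfl⟩
    obtain ⟨⟨q, hq⟩, hy⟩ := Set.mem_iUnion.1 hy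
    have h : ∃ w : List S, A.evalFrom A.start w = q ∧
        (t₀ : G) * (w.map (fun s : S => (s : G))).prod = D.emb (Multiplicative.ofAdd y) * t := by
      rcases hy with ⟨h1, rfl⟩ | h1
      · obtain ⟨h2, h3⟩ := Prod.mk_inj.1 h1
        exact ⟨[], by simpa using h2, by simp [h3]⟩
      · exact hwalk _ _ _ h1
    obtain ⟨w, hw, hz⟩ := h
    refine ⟨w, ?_, ?_⟩
    · change A.evalFrom A.start w ∈ A.accept
      rwa [hw]
    · change _ = D.emb (Multiplicative.ofAdd (z₀ + y)) * t
      rw [ofAdd_add, map_mul, mul_assoc, ← hz, ← mul_assoc, ← h₀, one_mul]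

end NFData

/-! ### Quasi-affine functions and definable sets -/

/-- A function `f : ℤ^ι → G` is quasi-affine with respect to a subgroup `A` of finite index if, on
each coset of `N ℤ^ι` with `N` the index of `A`, it is a translate of a homomorphism to `A`. -/
def IsQuasiAffine {G ι : Type*} [Group G] (A : Subgroup G) (f : (ι → ℤ) → G) : Prop :=
  ∀ c : ι → ℤ, ∃ (ψ : Multiplicative (ι → ℤ) →* G) (g : G), (∀ z, ψ z ∈ A) ∧
    ∀ z : ι → ℤ, f (c + A.index • z) = ψ (Multiplicative.ofAdd z) * g

namespace IsQuasiAffine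

variable {G ι κ : Type*} [Group G] {A : Subgroup G} {f f' : (ι → ℤ) → G}

lemma const (g : G) : IsQuasiAffine A (fun _ : ι → ℤ => g) :=
  fun _ => ⟨1, g, fun _ => one_mem A, fun _ => by simp⟩

/-- On multiples of the index `φ` takes values in `A`, since `φ (N z) = φ(z)^N` and `G ⧸ A` has
order `N`. -/
lemma of_monoidHom [A.Normal] (φ : Multiplicative (ι → ℤ) →* G) (h : G) :
    IsQuasiAffine A (fun z => φ (Multiplicative.ofAdd z) * h) := by
  intro c
  let e := AddMonoidHom.toMultiplicative (nsmulAddMonoidHom (α := ι → ℤ) A.index)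
  have hc : ∀ z : ι → ℤ, φ (Multiplicative.ofAdd (c + A.index • z)) =
      φ (Multiplicative.ofAdd (A.index • z)) * φ (Multiplicative.ofAdd c) := by
    intro z
    rw [add_comm, ofAdd_add, map_mul]
  refine ⟨φ.comp e, φ (Multiplicative.ofAdd c) * h, fun z => ?_, fun z => ?_⟩
  · change φ (z ^ A.index) ∈ A
    rw [map_pow]
    exact A.pow_index_mem _
  · beta_reduce
    rw [hc, mul_assoc]
    rfl

lemma comp_addMonoidHom (hf : IsQuasiAffine A f) (ρ : (κ → ℤ) →+ (ι → ℤ)) :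
    IsQuasiAffine A (fun z => f (ρ z)) := by
  intro c
  obtain ⟨ψ, g, hψ, h⟩ := hf (ρ c)
  refine ⟨ψ.comp (AddMonoidHom.toMultiplicative ρ), g, fun z => hψ _, fun z => ?_⟩
  beta_reduce
  rw [map_add, map_nsmul, h]
  rfl

lemma inv [A.Normal] (hA : ∀ x ∈ A, ∀ y ∈ A, x * y = y * x) (hf : IsQuasiAffine A f) :
    IsQuasiAffine A (fun z => (f z)⁻¹) := by
  intro c
  obtain ⟨ψ, g, hψ, h⟩ := hf c
  refine ⟨MonoidHom.mk' (fun z => g⁻¹ * (ψ z)⁻¹ * g) fun a b => ?_, g⁻¹, fun z => ?_, fun z => ?_⟩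
  · rw [map_mul, hA _ (hψ a) _ (hψ b)]
    group
  · simpa using Subgroup.Normal.conj_mem (H := A) inferInstance _ (inv_mem (hψ z)) g⁻¹
  · beta_reduce
    rw [h]
    simp

/-- Move the translation to the right: `ψ g ψ' g' = ψ (g ψ' g⁻¹) (g g')`. Normality keeps the
conjugate in `A`, and commutativity of `A` makes the product a homomorphism. -/
lemma mul [A.Normal] (hA : ∀ x ∈ A, ∀ y ∈ A, x * y = y * x) (hf : IsQuasiAffine A f)
    (hf' : IsQuasiAffine A f') : IsQuasiAffine A (fun z => f z * f' z) := by
  intro c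
  obtain ⟨ψ, g, hψ, h⟩ := hf c
  obtain ⟨ψ', g', hψ', h'⟩ := hf' c
  have hconj : ∀ z, g * ψ' z * g⁻¹ ∈ A := fun z =>
    Subgroup.Normal.conj_mem (H := A) inferInstance _ (hψ' z) g
  refine ⟨MonoidHom.mk' (fun z => ψ z * (g * ψ' z * g⁻¹)) fun a b => ?_, g * g', fun z => ?_,
    fun z => ?_⟩
  · have h1 := hA _ (hconj a) _ (hψ b)
    rw [map_mul, map_mul]
    calc ψ a * ψ b * (g * (ψ' a * ψ' b) * g⁻¹)
        = ψ a * (ψ b * (g * ψ' a * g⁻¹)) * (g * ψ' b * g⁻¹) := by group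
      _ = ψ a * (g * ψ' a * g⁻¹) * (ψ b * (g * ψ' b * g⁻¹)) := by rw [← h1]; group
  · exact mul_mem (hψ z) (hconj z)
  · beta_reduce
    rw [h, h']
    simp [mul_assoc]

open scoped Pointwise in
-- On each of the finitely many residue classes modulo the index the equation reads `ψ z = g⁻¹`:
-- unsolvable if `g⁻¹ ∉ A`, otherwise the preimage of a point under a homomorphism of abelian
-- groups.
theorem isSemilinearSet_eq_one [Finite ι] [A.FiniteIndex]
    (hA : ∀ x ∈ A, ∀ y ∈ A, x * y = y * x) (hf : IsQuasiAffine A f) :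
    IsSemilinearSet {z | f z = 1} := by
  let : CommGroup A := { (inferInstance : Group A) with
    mul_comm := fun x y => Subtype.ext (hA x x.2 y y.2) }
  choose ψ g hψ h using hf
  have hN : A.index ≠ 0 := Subgroup.FiniteIndex.index_ne_zero
  have : NeZero A.index := ⟨hN⟩
  have hpiece : ∀ c, IsSemilinearSet {z | ψ c (Multiplicative.ofAdd z) * g c = 1} := by
    intro c
    by_cases hg : (g c)⁻¹ ∈ A
    · let θ : (ι → ℤ) →+ Additive A :=
        { toFun := fun z => Additive.ofMul ⟨ψ c (Multiplicative.ofAdd z), hψ c _⟩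
          map_zero' := congrArg Additive.ofMul (Subtype.ext (map_one (ψ c)))
          map_add' := fun a b => congrArg Additive.ofMul (Subtype.ext (map_mul (ψ c) _ _)) }
      convert! (IsSemilinearSet.singleton (Additive.ofMul (⟨(g c)⁻¹, hg⟩ : A))).preimage θ using 1
      ext z
      constructor
      · intro hz
        exact congrArg Additive.ofMul (Subtype.ext (eq_inv_of_mul_eq_one_left hz))
      · intro hz
        have := Subtype.ext_iff.1 (Additive.ofMul.injective hz)
        exact mul_eq_one_iff_eq_inv.2 this
    · convert! IsSemilinearSet.empty using 1
      rw [Set.eq_empty_iff_forall_notMem]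
      intro z hz
      exact hg (eq_inv_of_mul_eq_one_left hz ▸ hψ c _)
  have hfin : IsSemilinearSet (⋃ r : ι → Fin A.index, (fun i => ((r i : ℕ) : ℤ)) +ᵥ
      (nsmulAddMonoidHom (α := ι → ℤ) A.index ''
        {z | ψ (fun i => ((r i : ℕ) : ℤ)) (Multiplicative.ofAdd z) *
          g (fun i => ((r i : ℕ) : ℤ)) = 1})) :=
    IsSemilinearSet.iUnion fun r => ((hpiece _).image _).vadd _
  convert! hfin using 1
  ext z
  rw [Set.mem_iUnion]
  constructor
  · intro hz
    have hpos : (0 : ℤ) < A.index := by exact_mod_cast Nat.pos_of_ne_zero hN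
    have hr : ∀ i, ∃ r : Fin A.index, ((r : ℕ) : ℤ) = z i % A.index := by
      intro i
      refine ⟨⟨(z i % A.index).toNat, ?_⟩, Int.toNat_of_nonneg (Int.emod_nonneg _ hpos.ne')⟩
      have := Int.emod_lt_of_pos (z i) hpos
      omega
    choose r hr using hr
    have hzr : z = (fun i => ((r i : ℕ) : ℤ)) + A.index • fun i => z i / A.index := by
      ext i
      simp [hr, Int.emod_add_mul_ediv]
    refine ⟨r, _, ⟨fun i => z i / A.index, ?_, rfl⟩, hzr.symm⟩
    change _ = _
    rw [← h, ← hzr]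
    exact hz
  · rintro ⟨r, _, ⟨y, hy, rfl⟩, rfl⟩
    exact (h _ y).trans hy

end IsQuasiAffine

/-! ### First-order formulas along quasi-affine functions -/

open FirstOrder Language

section Definable

variable {G : Type*} [Group G] {A : Subgroup G}

lemma IsQuasiAffine.term_realize [A.Normal] (hA : ∀ x ∈ A, ∀ y ∈ A, x * y = y * x) {β ι : Type*}
    (t : groupLanguage.Term β) (f : β → (ι → ℤ) → G) (hf : ∀ b, IsQuasiAffine A (f b)) :
    IsQuasiAffine A (fun z => t.realize fun b => f b z) := by
  induction t with
  | var b => exact hf b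
  | func F ts ih =>
    cases F with
    | one => exact IsQuasiAffine.const 1
    | inv => exact (ih 0).inv hA
    | mul => exact (ih 0).mul hA (ih 1)

/-- A finitely generated abelian subgroup of finite index is the image of some `ℤ^k`. -/
lemma Subgroup.exists_cover_of_finiteIndex [Group.FG G] [A.FiniteIndex]
    (hA : ∀ x ∈ A, ∀ y ∈ A, x * y = y * x) :
    ∃ (k : ℕ) (α : Multiplicative (Fin k → ℤ) →* G) (T : Set G), T.Finite ∧
      ∀ g, ∃ y : Fin k → ℤ, ∃ t ∈ T, g = α (Multiplicative.ofAdd y) * t := by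
  let : CommGroup A := { (inferInstance : Group A) with
    mul_comm := fun x y => Subtype.ext (hA x x.2 y y.2) }
  have hfg : AddGroup.FG (Additive A) := GroupFG.iff_add_fg.1 (A.fg_of_index_ne_zero)
  obtain ⟨k, φ, hφ⟩ := AddSubgroup.fg_iff_exists_fin_addMonoidHom.1 hfg.out
  obtain ⟨T, hT, -⟩ := A.exists_isComplement_right 1
  refine ⟨k, A.subtype.comp (AddMonoidHom.toMultiplicativeLeft φ), T, hT.finite_right, fun g => ?_⟩
  obtain ⟨⟨a, t⟩, h⟩ := hT.2 g
  obtain ⟨y, hy⟩ : Additive.ofMul a ∈ φ.range := by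
    rw [hφ]
    trivial
  refine ⟨y, t, t.2, ?_⟩
  rw [← h]
  exact congrArg (fun b : Additive A => ((b.toMul : A) : G) * t) hy.symm

/-- The number of integer variables must vary in the induction: each quantifier adds `k` of them,
coordinates for the quantified group element. -/
theorem IsQuasiAffine.isSemilinearSet_realize [Group.FG G] [A.Normal] [A.FiniteIndex]
    (hA : ∀ x ∈ A, ∀ y ∈ A, x * y = y * x) {β : Type*} {l : ℕ}
    (φ : groupLanguage.BoundedFormula β l) {ι : Type} [Finite ι] (f : β → (ι → ℤ) → G)
    (x : Fin l → (ι → ℤ) → G) (hf : ∀ b, IsQuasiAffine A (f b))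
    (hx : ∀ j, IsQuasiAffine A (x j)) :
    IsSemilinearSet {z | φ.Realize (fun b => f b z) (fun j => x j z)} := by
  induction φ generalizing ι with
  | falsum => exact IsSemilinearSet.empty
  | equal t₁ t₂ =>
    have h : ∀ b, IsQuasiAffine A (Sum.elim f x b) := by
      rintro (b | j)
      exacts [hf b, hx j]
    have he : ∀ z, (fun b => (Sum.elim f x b) z) = Sum.elim (fun b => f b z) (fun j => x j z) := by
      intro z
      ext (b | j) <;> rfl
    convert! (((term_realize hA t₁ _ h).mul hA
      ((term_realize hA t₂ _ h).inv hA)).isSemilinearSet_eq_one hA) using 1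
    ext z
    simp only [he, mul_inv_eq_one]
    rfl
  | rel R => nomatch R
  | imp _ _ ih₁ ih₂ =>
    convert! ((ih₁ f x hf hx).inter (ih₂ f x hf hx).compl).compl using 1
    ext z
    simp [BoundedFormula.Realize]
  | @all l φ ih =>
    obtain ⟨k, α, T, hT, hcover⟩ := Subgroup.exists_cover_of_finiteIndex hA
    let ρ₁ : (ι ⊕ Fin k → ℤ) →+ (ι → ℤ) := (LinearMap.funLeft ℤ ℤ Sum.inl).toAddMonoidHom
    let ρ₂ : (ι ⊕ Fin k → ℤ) →+ (Fin k → ℤ) := (LinearMap.funLeft ℤ ℤ Sum.inr).toAddMonoidHom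
    have hsnoc : ∀ (t : G) (w : ι ⊕ Fin k → ℤ),
        (fun j => (Fin.snoc (α := fun _ => (ι ⊕ Fin k → ℤ) → G) (fun j w => x j (ρ₁ w))
          (fun w => α (Multiplicative.ofAdd (ρ₂ w)) * t) : Fin (l + 1) → _) j w) =
        Fin.snoc (α := fun _ => G) (fun j => x j (ρ₁ w))
          (α (Multiplicative.ofAdd (ρ₂ w)) * t) := by
      intro t w
      ext j
      refine Fin.lastCases ?_ (fun j => ?_) j <;> simp
    -- Counterexamples to the universal statement lying in `α(ℤ^k) t`: a projection, whereas the
    -- statement itself is not.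
    have hpiece : ∀ t : G, IsSemilinearSet {z | ∃ y : Fin k → ℤ, ¬ φ.Realize (fun b => f b z)
        (Fin.snoc (α := fun _ => G) (fun j => x j z) (α (Multiplicative.ofAdd y) * t))} := by
      intro t
      apply IsSemilinearSet.proj'
      have h := ih (fun b w => f b (ρ₁ w)) (Fin.snoc (α := fun _ => (ι ⊕ Fin k → ℤ) → G)
        (fun j w => x j (ρ₁ w)) (fun w => α (Multiplicative.ofAdd (ρ₂ w)) * t))
        (fun b => (hf b).comp_addMonoidHom ρ₁) (by
          refine Fin.lastCases ?_ (fun j => ?_)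
          · simpa using (of_monoidHom α t).comp_addMonoidHom ρ₂
          · simpa using (hx j).comp_addMonoidHom ρ₁)
      simp only [hsnoc] at h
      exact h.compl
    convert! (IsSemilinearSet.biUnion hT fun t _ => hpiece t).compl using 1
    ext z
    simp only [BoundedFormula.realize_all, Set.mem_compl_iff, Set.mem_iUnion, not_exists]
    constructor
    · rintro h t _ ⟨y, hy⟩
      exact hy (h _)
    · intro h a
      obtain ⟨y, t, ht, rfl⟩ := hcover a
      by_contra hc
      exact h t ht ⟨y, hc⟩

end Definable

/-- A definable subset of `G^n` has semilinear traces on the cosets of any image of `ℤ^m`. -/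
theorem isSemilinearSet_of_isDefinableSubset {G : Type*} [Group G] [Group.FG G]
    (hG : IsVirtuallyAbelian G) {n : ℕ} {U : Set (Fin n → G)} (hU : IsDefinableSubset U) {m : ℕ}
    (φ : Multiplicative (Fin m → ℤ) →* (Fin n → G)) (h : Fin n → G) :
    IsSemilinearSet {z : Fin m → ℤ | φ (Multiplicative.ofAdd z) * h ∈ U} := by
  obtain ⟨A, _, hA⟩ := hG
  obtain ⟨F, rfl⟩ := Set.definable_iff_exists_formula_sum.1 hU
  -- Quasi-affine functions are closed under products only for normal subgroups, so `A` is replaced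
  -- by its core, still of finite index.
  have hcore : ∀ x ∈ A.normalCore, ∀ y ∈ A.normalCore, x * y = y * x :=
    fun x hx y hy => hA x (A.normalCore_le hx) y (A.normalCore_le hy)
  have key := IsQuasiAffine.isSemilinearSet_realize hcore F
    (Sum.elim (fun g _ => (g : G)) fun i (z : Fin m → ℤ) => (φ (Multiplicative.ofAdd z) * h) i)
    (fun j _ => (default : Fin 0 → G) j) (by
      rintro (g | i)
      · exact IsQuasiAffine.const _
      · exact IsQuasiAffine.of_monoidHom ((Pi.evalMonoidHom _ i).comp φ) (h i))
    (fun j => j.elim0)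
  convert! key using 2
  ext z
  change F.Realize _ ↔ BoundedFormula.Realize F _ _
  rw [Formula.Realize]
  convert Iff.rfl using 2
  · ext (g | i) <;> rfl

theorem mainTheorem8 {G : Type u} [Group G] [Group.FG G] (hG : IsVirtuallyAbelian G) :
    (∀ (D : NFData G) (U : Set G), IsRationalSubset U → IsEDT0L (D.NF U)) ∧
    (∀ (n : ℕ) (D : NFData (Fin n → G)) (U : Set (Fin n → G)),
      IsDefinableSubset U → IsEDT0L (D.NF U)) :=
  ⟨fun D U hU => D.isEDT0L_NF U (D.isSemilinearSet_of_isRationalSubset hU),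
    fun _ D U hU => D.isEDT0L_NF U fun t => isSemilinearSet_of_isDefinableSubset hG hU D.emb t⟩
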